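/- Let $2\le s\le d$ and $n\ge 1$ be integers and $\alpha\in(0,1)$. Let $\mathrm{Conv}^s\subseteq C(\mathbb R^d,\mathbb R)$ be the set of deep ReLU convolutional networks with filter sparsity $s$, i.e. of all functions $f=W\circ f^{(J)}$ with $J\ge 1$, $W:\mathbb R^{d+Js}\to\mathbb R$ affine, and $$f^{(0)}(x)=x,\qquad f^{(j)}(x)=\sigma\bullet\big(w^{(j)}\star f^{(j-1)}(x)-b^{(j)}\big)\in\mathbb R^{d+js},\qquad j=1,\dots,J,$$ where $\sigma(t)=\max\{0,t\}$ acts componentwise, $b^{(j)}\in\mathbb R^{d+js}$, $w^{(j)}=(w^{(j)}_k)_{k\in\mathbb Z}$ is a real sequence with $w^{(j)}_k\ne 0$ only if $0\le k\le s$, and $(w\star v)_i=\sum_{l=0}^{D-1}w_{i-l}v_l$ for $v=(v_0,\dots,v_{D-1})\in\mathbb R^D$. Let $\mathcal X$ be a metric space, let $\mathcal X_1,\dots,\mathcal X_n\subseteq\mathcal X$ be open, and let $\hat h:\mathcal X\to\{0,1\}^n$, $\hat h(x)_i=I_{\mathcal X_i}(x)$, be their ideal classifier, where $\{0,1\}^n$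 carries the $n$-fold product of the Sierpiński topology $\{\emptyset,\{1\},\{0,1\}\}$. Let $\phi:\mathcal X\to\mathbb R^d$ be continuous and injective, and let $\rho:\mathbb R\to(0,1)$, $\rho(t)=e^t/(1+e^t)$, be the logistic function, applied componentwise. Spaces of continuous functions carry the compact-open topology. Then: (i) (Hard-soft decomposition) There is a continuous $\hat s=(\hat s_1,\dots,\hat s_n):\mathcal X\to[0,1]^n$ such that $$\hat h=I_{(\alpha,1]}\bullet\hat s\quad\text{and}\quad \hat s_i^{-1}[(\alpha,1]]=\mathcal X_i\ \text{ for } i=1,\dots,n.\qquad(*)$$ (ii) (Universal classification) Suppose that $\mathcal X$ is locally compact and separable, or that $\phi$ is a homeomorphism onto its image (in particular, this covers the case where $\mathcal X$ is homeomorphic to a Euclidean space). Then for every continuous $\hat s:\mathcal X\to[0,1]^n$ satisfying $(*)$ there is a sequence $(f_k)_{k\in\mathbb N}$ of $n$-tuples $f_k=(f_{k,1},\dots,f_{k,n})$ of networks $f_{k,i}\in \mathrm{Conv}^s$ such that (a) (soft classification) for every non-empty compact $\kappa\subseteq\mathcal X$ and every $\epsilon>0$ there is $K$ with $$\sup_{x\in\kappa}\max_{i=1,\dots,n}\big|\rho(f_{k,i}(\phi(x)))-\hat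 s_i(x)\big|<\epsilon\qquad(\forall k\ge K);$$ (b) (hard classification) $I_{(\alpha,1]}\bullet\rho\circ f_k\circ\phi$ converges to $\hat h$ in $C(\mathcal X,\{0,1\}^n)$. (iii) The set $\{\rho\circ f\circ\phi:\ f=(f_1,\dots,f_n),\ f_i\in\mathrm{Conv}^s\}$ is dense in $C(\mathcal X,[0,1]^n)$. -/

import Mathlib

open Topology Filter unitInterval

/-- A convolutional filter mask with sparsity `s`: a bilateral real sequence whose entry at `k`
can be nonzero only if `0 ≤ k ≤ s`. -/
def IsFilterMask (s : ℕ) (w : ℤ → ℝ) : Prop :=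
  ∀ k : ℤ, w k ≠ 0 → 0 ≤ k ∧ k ≤ (s : ℤ)

/-- The convolution `(w ⋆ v)_i = ∑_{j=0}^{D-1} w_{i-j} v_j` of a bilateral sequence with a vector
`v = (v_0, …, v_{D-1})`. -/
def filterConv {D : ℕ} (w : ℤ → ℝ) (v : Fin D → ℝ) (i : ℤ) : ℝ :=
  ∑ j : Fin D, w (i - (j : ℤ)) * v j

/-- The `j`-th hidden layer of a convolutional ReLU network: `f⁽⁰⁾(x) = x` and
`f⁽ʲ⁾(x) = σ • (w⁽ʲ⁾ ⋆ f⁽ʲ⁻¹⁾(x) - b⁽ʲ⁾)`, with `σ(t) = max 0 t`. Its width is `d + j s`.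
The values `w 0` and `b 0` are not used. -/
def convLayer (d s : ℕ) (w : ℕ → ℤ → ℝ) (b : (j : ℕ) → Fin (d + j * s) → ℝ)
    (x : EuclideanSpace ℝ (Fin d)) : (j : ℕ) → Fin (d + j * s) → ℝ
  | 0 => fun i => x (Fin.cast (by simp) i)
  | j + 1 => fun i =>
      max 0 (filterConv (w (j + 1)) (convLayer d s w b x j) (i : ℤ) - b (j + 1) i)

/-- The set `Conv^s` of deep convolutional ReLU networks from `ℝ^d` to `ℝ` with filter
sparsity `s`: the functions `W ∘ f⁽ᴶ⁾` with `J ≥ 1` hidden layers and `W` affine. (Every such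
function is continuous, so nothing is lost by collecting them inside `C(ℝ^d, ℝ)`.) -/
def DeepCNN (d s : ℕ) : Set C(EuclideanSpace ℝ (Fin d), ℝ) :=
  {f | ∃ (J : ℕ) (w : ℕ → ℤ → ℝ) (b : (j : ℕ) → Fin (d + j * s) → ℝ)
      (W : (Fin (d + J * s) → ℝ) →ᵃ[ℝ] ℝ),
      1 ≤ J ∧ (∀ j, IsFilterMask s (w j)) ∧ ∀ x, f x = W (convLayer d s w b x J)}

/-- `ρ ∘ f ∘ φ : X → [0,1]^n` for an `n`-tuple `f = (f_1, …, f_n)` of real functions and the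
componentwise logistic function `ρ`. -/
noncomputable def logisticLift {X : Type*} [TopologicalSpace X] {d n : ℕ}
    (φ : C(X, EuclideanSpace ℝ (Fin d))) (f : Fin n → C(EuclideanSpace ℝ (Fin d), ℝ)) :
    C(X, Fin n → I) where
  toFun x i := unitInterval.sigmoid (f i (φ x))
  continuous_toFun := continuous_pi fun i =>
    unitInterval.continuous_sigmoid.comp ((f i).continuous.comp φ.continuous)

/-- Componentwise thresholding `I_{(α,1]} • · : [0,1]^n → {0,1}^n`. The set `{0,1}` with the
Sierpiński topology (`{1}` open) is `Prop` with its topology `sierpinskiSpace`, where `True` is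
the value `1`; `Fin n → Prop` carries the product topology. -/
def hardThreshold (α : ℝ) (n : ℕ) : C(Fin n → I, Fin n → Prop) where
  toFun y i := (y i : ℝ) ∈ Set.Ioc α 1
  continuous_toFun := continuous_pi fun i => continuous_Prop.2 <| by
    have h : {y : Fin n → I | (y i : ℝ) ∈ Set.Ioc α 1} = {y | α < (y i : ℝ)} := by
      ext y
      exact ⟨fun hy => hy.1, fun hy => ⟨hy, (y i).2.2⟩⟩
    rw [h]
    exact isOpen_lt continuous_const (continuous_subtype_val.comp (continuous_apply i))

/-- The ideal classifier `ĥ : X → {0,1}^n`, `ĥ(x)_i = I_{X_i}(x)`, of a family of open sets, as a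
continuous map into the `n`-fold product of Sierpiński spaces. -/
def idealClassifier {X : Type*} [TopologicalSpace X] {n : ℕ}
    (U : Fin n → TopologicalSpace.Opens X) : C(X, Fin n → Prop) where
  toFun x i := x ∈ U i
  continuous_toFun := continuous_pi fun i => continuous_Prop.2 (U i).isOpen

/-- `ŝ ∈ C(X, [0,1]^n)` is a soft classifier at level `α` for the family `U`: thresholding it gives
the ideal classifier, and `ŝ_i⁻¹[(α,1]] = U_i` for every `i`. -/
def IsSoftClassifier {X : Type*} [TopologicalSpace X] {n : ℕ} (α : ℝ)
    (U : Fin n → TopologicalSpace.Opens X) (ŝ : C(X, Fin n → I)) : Prop :=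
  idealClassifier U = (hardThreshold α n).comp ŝ ∧
    ∀ i, (fun x => (ŝ x i : ℝ)) ⁻¹' Set.Ioc α 1 = (U i : Set X)

/-!
The heart of the matter is that deep convolutional ReLU networks are dense in `C(ℝ^d, ℝ)` for the
compact-open topology (`dense_deepCNN`), which rests on two facts.

* On a compact set a shallow network `∑ c_m max 0 (⟪a_m, x⟫ - t_m)` *is* a deep convolutional one
  (`exists_deepCNN_eqOn`). Convolution of filters is multiplication of polynomials. One long filter
  can carry all the weight vectors `a_m` one after the other, so that convolving it with `x` yields
  all the `⟪a_m, x⟫` in suitable coordinates. Over `ℝ` the corresponding polynomial is a product of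
  factors of degree at most `2 ≤ s`, that is, of admissible filters. Biases large enough keep all
  rectifiers before the last layer in their linear range on the compact set; the last layer, whose
  biases are free, supplies the thresholds `t_m`, and the affine output map supplies the `c_m`.
* Shallow networks are dense (`dense_span_reluRidge`). Piecewise linear interpolation shows that
  their closure contains every `x ↦ h ⟪a, x⟫` with `h` continuous, in particular the exponentials
  `exp ⟪a, x⟫`, whose span is an algebra that separates points.

The logistic function maps `ℝ` homeomorphically onto `(0, 1)`, so networks followed by it are dense
in `C(ℝ^d, [0, 1])`. A continuous function on a compact `K ⊆ X` factors through the embedding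
`φ|_K`, and Tietze's theorem extends it to `ℝ^d`; this gives the density in `C(X, [0, 1]^n)`.

A *sequence* of networks needs a sequence `G_k` on `ℝ^d` such that `G_k ∘ φ` converges to the soft
classifier uniformly on compact sets. If `X` is locally compact and separable, it is obtained from
a compact exhaustion. If `φ` is an embedding, its image may be neither closed nor locally compact,
and `C(X, [0, 1])` need not be first countable; there the Lipschitz regularizations
`inf_a (g a + k |y - a|)` serve (`exists_seq_restrict_tendsto`). Convergence of the hard classifiers
is then the continuity of composition with the thresholding map. Finally, `U` is the set where
`α + (1 - α) min (1, dist(x, Uᶜ))` exceeds `α`, which gives the soft classifiers.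
-/

/-! ### Convolution and multiplication of polynomials -/

open Polynomial in
/-- The coefficient sequence of a polynomial, extended by zero to negative indices. Convolution
with it is multiplication by the polynomial. -/
noncomputable def filterMask (p : ℝ[X]) (k : ℤ) : ℝ :=
  if 0 ≤ k then p.coeff k.toNat else 0

open Polynomial in
theorem isFilterMask_filterMask {s : ℕ} {p : ℝ[X]} (hp : p.natDegree ≤ s) :
    IsFilterMask s (filterMask p) := by
  intro k hk
  unfold filterMask at hk
  split_ifs at hk with h
  · have := le_natDegree_of_ne_zero hk
    omega
  · exact absurd rfl hk

open Polynomial in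
theorem filterConv_filterMask {D : ℕ} (p q : ℝ[X]) (hq : q.degree < D) (i : ℕ) :
    filterConv (filterMask p) (fun j : Fin D => q.coeff j) i = (q * p).coeff i := by
  have hq' : ∀ j, D ≤ j → q.coeff j = 0 := (degree_lt_iff_coeff_zero q D).1 hq
  unfold filterConv
  rw [Fin.sum_univ_eq_sum_range (fun j => filterMask p ((i : ℤ) - (j : ℤ)) * q.coeff j) D,
    coeff_mul, Finset.Nat.sum_antidiagonal_eq_sum_range_succ (fun a b => q.coeff a * p.coeff b)]
  trans ∑ j ∈ Finset.range (D + (i + 1)), filterMask p ((i : ℤ) - (j : ℤ)) * q.coeff j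
  · apply Finset.sum_subset
    · exact Finset.range_subset_range.2 (by omega)
    · intro j _ hj
      rw [hq' j (by simpa using hj), mul_zero]
  · symm
    rw [Finset.sum_congr rfl (g := fun j : ℕ => filterMask p ((i : ℤ) - (j : ℤ)) * q.coeff j)]
    · apply Finset.sum_subset
      · exact Finset.range_subset_range.2 (by omega)
      · intro j _ hj
        have : ¬ (0 ≤ (i : ℤ) - (j : ℤ)) := by
          have : ¬ j < i + 1 := by simpa using hj
          omega
        rw [filterMask, if_neg this, zero_mul]
    · intro j hj
      have h1 : j < i + 1 := by simpa using hj
      have h2 : (0 : ℤ) ≤ (i : ℤ) - (j : ℤ) := by omega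
      have h3 : ((i : ℤ) - (j : ℤ)).toNat = i - j := by omega
      simp only [filterMask, if_pos h2, h3]
      ring

theorem filterConv_add {D : ℕ} (w : ℤ → ℝ) (u v : Fin D → ℝ) (i : ℤ) :
    filterConv w (fun j => u j + v j) i = filterConv w u i + filterConv w v i := by
  simp [filterConv, mul_add, Finset.sum_add_distrib]

open Polynomial in
theorem degree_mul_lt_of_natDegree_le {a b : ℝ[X]} {m n : ℕ} (ha : a.degree < m)
    (hb : b.natDegree ≤ n) : (a * b).degree < (m + n : ℕ) := by
  by_cases h : a = 0
  · subst h
    simp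
  · have h1 : a.natDegree < m := (natDegree_lt_iff_degree_lt h).2 ha
    refine lt_of_le_of_lt degree_le_natDegree ?_
    have := natDegree_mul_le (p := a) (q := b)
    exact_mod_cast (by omega : (a * b).natDegree < m + n)

/-! ### Hidden layers with large biases -/

open Polynomial in
/-- The input vector times the first `j` filters, as polynomials: the linear part of layer `j`. -/
noncomputable def linearPart {d : ℕ} (q : ℕ → ℝ[X]) (x : EuclideanSpace ℝ (Fin d)) (j : ℕ) :
    ℝ[X] :=
  ofFn d (fun k => x k) * ∏ l ∈ Finset.range j, q l

open Polynomial in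
theorem degree_linearPart_lt {d s : ℕ} {q : ℕ → ℝ[X]} (hq : ∀ l, (q l).natDegree ≤ s)
    (x : EuclideanSpace ℝ (Fin d)) (j : ℕ) : (linearPart q x j).degree < (d + j * s : ℕ) := by
  refine degree_mul_lt_of_natDegree_le (ofFn_degree_lt _) ?_
  refine (natDegree_prod_le _ _).trans ?_
  simpa using Finset.sum_le_card_nsmul (Finset.range j) (fun l => (q l).natDegree) s
    (fun l _ => hq l)

open Polynomial in
theorem continuous_coeff_linearPart {d : ℕ} (q : ℕ → ℝ[X]) (j i : ℕ) :
    Continuous fun x : EuclideanSpace ℝ (Fin d) => (linearPart q x j).coeff i :=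
  (((lcoeff ℝ i).comp (LinearMap.mulRight ℝ (∏ l ∈ Finset.range j, q l))).comp
    ((ofFn d).comp (WithLp.linearEquiv 2 ℝ (Fin d → ℝ)).toLinearMap)
      ).continuous_of_finiteDimensional

open Polynomial in
/-- Biases which turn layer `j + 1` into `max 0 (linear part + T (j + 1))`, provided that layer `j`
is its linear part shifted by `T j`. -/
noncomputable def shiftBias (d s : ℕ) (q : ℕ → ℝ[X]) (T : ℕ → ℕ → ℝ) :
    (j : ℕ) → Fin (d + j * s) → ℝ
  | 0 => 0
  | j + 1 => fun i =>
      filterConv (filterMask (q j)) (fun k : Fin (d + j * s) => T j k) (i : ℤ) - T (j + 1) i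

open Polynomial in
/-- The filters of a network are numbered from `1` and the polynomials `q` from `0`, which explains
the index `l - 1`; the value at `l = 0` plays no role. -/
theorem convLayer_succ_of_shift {d s : ℕ} {q : ℕ → ℝ[X]} (hq : ∀ l, (q l).natDegree ≤ s)
    (T : ℕ → ℕ → ℝ) (x : EuclideanSpace ℝ (Fin d)) (j : ℕ)
    (h : ∀ i, convLayer d s (fun l => filterMask (q (l - 1))) (shiftBias d s q T) x j i =
      (linearPart q x j).coeff i + T j i) (i : Fin (d + (j + 1) * s)) :
    convLayer d s (fun l => filterMask (q (l - 1))) (shiftBias d s q T) x (j + 1) i =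
      max 0 ((linearPart q x (j + 1)).coeff i + T (j + 1) i) := by
  have h' := funext h
  simp only [convLayer, h', shiftBias, Nat.add_sub_cancel]
  rw [filterConv_add, filterConv_filterMask _ _ (degree_linearPart_lt hq x j)]
  simp only [linearPart, Finset.prod_range_succ, mul_assoc]
  congr 1
  ring

open Polynomial in
/-- When the shifts dominate the linear parts, no rectifier before layer `J` cuts anything off, so
that the layers below `J` act affinely and the last one applies the rectifier to an affine map. -/
theorem convLayer_eq_max {d s : ℕ} {q : ℕ → ℝ[X]} (hq : ∀ l, (q l).natDegree ≤ s)
    (T : ℕ → ℕ → ℝ) (hT0 : ∀ i, T 0 i = 0) (x : EuclideanSpace ℝ (Fin d)) {J : ℕ}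
    (hT : ∀ j < J, 1 ≤ j → ∀ i, |(linearPart q x j).coeff i| ≤ T j i) (hJ : 1 ≤ J)
    (i : Fin (d + J * s)) :
    convLayer d s (fun l => filterMask (q (l - 1))) (shiftBias d s q T) x J i =
      max 0 ((linearPart q x J).coeff i + T J i) := by
  have key : ∀ j < J, ∀ i,
      convLayer d s (fun l => filterMask (q (l - 1))) (shiftBias d s q T) x j i =
        (linearPart q x j).coeff i + T j i := by
    intro j
    induction j with
    | zero =>
      intro _ i
      have hi : (i : ℕ) < d := by have := i.2; omega
      simp only [convLayer, linearPart, Finset.range_zero, Finset.prod_empty, mul_one, hT0,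
        add_zero]
      rw [ofFn_coeff_eq_val_of_lt _ hi]
      rfl
    | succ j ih =>
      intro hj i
      rw [convLayer_succ_of_shift hq T x j (ih (by omega)) i]
      have := neg_abs_le ((linearPart q x (j + 1)).coeff i)
      have := hT (j + 1) hj (by omega) i
      exact max_eq_right (by linarith)
  obtain ⟨j, rfl⟩ : ∃ j, J = j + 1 := ⟨J - 1, by omega⟩
  exact convLayer_succ_of_shift hq T x j (key j (by omega)) i

theorem continuous_convLayer {d s : ℕ} (w : ℕ → ℤ → ℝ) (b : (j : ℕ) → Fin (d + j * s) → ℝ)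
    (j : ℕ) : Continuous fun x : EuclideanSpace ℝ (Fin d) => convLayer d s w b x j := by
  induction j with
  | zero => exact continuous_pi fun i => by simp only [convLayer]; fun_prop
  | succ j ih =>
    refine continuous_pi fun i => ?_
    simp only [convLayer, filterConv]
    fun_prop

/-! ### Factorization of long filters -/

open Polynomial in
/-- Every real polynomial is a product of factors of degree at most two; the sequence of factors
is continued by `1`. -/
theorem exists_prod_natDegree_le_two (W : ℝ[X]) :
    ∃ (m : ℕ) (q : ℕ → ℝ[X]), 1 ≤ m ∧ (∀ l, (q l).natDegree ≤ 2) ∧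
      ∀ J ≥ m, ∏ l ∈ Finset.range J, q l = W := by
  have const : ∀ W : ℝ[X], W.natDegree = 0 → ∃ (m : ℕ) (q : ℕ → ℝ[X]), 1 ≤ m ∧
      (∀ l, (q l).natDegree ≤ 2) ∧ ∀ J ≥ m, ∏ l ∈ Finset.range J, q l = W := by
    intro W hW
    refine ⟨1, fun l => if l = 0 then W else 1, le_rfl, fun l => ?_, fun J hJ => ?_⟩
    · dsimp only
      split_ifs <;> simp [hW]
    · rw [Finset.prod_ite_eq' (Finset.range J) 0 (fun _ => W)]
      simp [show 0 < J by omega]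
  induction W using WfDvdMonoid.induction_on_irreducible with
  | zero => exact const 0 natDegree_zero
  | unit u hu => exact const u (natDegree_eq_zero_of_isUnit hu)
  | mul a i _ hi ih =>
    obtain ⟨m, q, -, hq, hprod⟩ := ih
    refine ⟨m + 1, fun l => Nat.casesOn l i q, by omega, fun l => ?_, fun J hJ => ?_⟩
    · cases l
      · exact hi.natDegree_le_two
      · exact hq _
    · obtain ⟨J, rfl⟩ : ∃ k, J = k + 1 := ⟨J - 1, by omega⟩
      rw [Finset.prod_range_succ', hprod J (by omega)]
      exact mul_comm a i

/-! ### Shallow networks as deep convolutional networks -/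

/-- The ridge function `x ↦ max 0 (⟪a, x⟫ - t)` of a single rectified linear unit. -/
noncomputable def reluRidge {d : ℕ} (a : EuclideanSpace ℝ (Fin d)) (t : ℝ) :
    C(EuclideanSpace ℝ (Fin d), ℝ) where
  toFun x := max 0 (inner ℝ a x - t)
  continuous_toFun := by fun_prop

open Polynomial in
/-- A filter carrying the reversed weight vectors `a 0, …, a (M - 1)` one after the other computes
all inner products `⟪a m, x⟫`, in the coordinates `m * d + (d - 1)`. -/
theorem exists_coeff_eq_inner {d : ℕ} (M : ℕ) (a : Fin M → EuclideanSpace ℝ (Fin d)) :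
    ∃ W : ℝ[X], ∀ (x : EuclideanSpace ℝ (Fin d)) (m : Fin M),
      (ofFn d (fun k => x k) * W).coeff (m * d + (d - 1)) = inner ℝ (a m) x := by
  refine ⟨∑ m : Fin M, ∑ k : Fin d, monomial (m * d + (d - 1 - k)) (a m k), fun x m => ?_⟩
  have hW : ∀ k : Fin d,
      (∑ m : Fin M, ∑ k : Fin d, monomial (m * d + (d - 1 - k)) (a m k)).coeff
        (m * d + (d - 1 - k)) = a m k := by
    intro k
    simp only [finsetSum_coeff, coeff_monomial]
    rw [Finset.sum_eq_single m, Finset.sum_eq_single k]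
    · simp
    · intro k' _ hk'
      have := Fin.val_ne_of_ne hk'
      rw [if_neg]
      omega
    · simp
    · intro m' _ hm'
      refine Finset.sum_eq_zero fun k' _ => if_neg fun h => hm' ?_
      have hd : 0 < d := k.pos
      have h1 := congrArg (· / d) h
      simp only [mul_comm _ d, Nat.mul_add_div hd] at h1
      rw [Nat.div_eq_of_lt (by omega), Nat.div_eq_of_lt (by omega)] at h1
      exact Fin.ext (by simpa using h1)
    · simp
  generalize (∑ m : Fin M, ∑ k : Fin d, monomial (m * d + (d - 1 - k)) (a m k) : ℝ[X]) = W at hW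
  rw [← filterConv_filterMask W _ (ofFn_degree_lt _), PiLp.inner_apply]
  refine Finset.sum_congr rfl fun k _ => ?_
  have h0 : (0 : ℤ) ≤ ((m * d + (d - 1) : ℕ) : ℤ) - (k : ℤ) := by omega
  have h1 : (((m * d + (d - 1) : ℕ) : ℤ) - (k : ℤ)).toNat = m * d + (d - 1 - k) := by omega
  simp only [filterMask, if_pos h0, h1, hW k, ofFn_coeff_eq_val_of_lt _ k.2]
  simp [mul_comm]

open Polynomial in
/-- On a compact set a shallow network coincides with a deep convolutional one: all weight vectors
are placed in one long filter, which is then factored into short ones. -/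
theorem exists_deepCNN_eqOn {d s : ℕ} (hs : 2 ≤ s) (hd : 1 ≤ d) (M : ℕ)
    (a : Fin M → EuclideanSpace ℝ (Fin d)) (t c : Fin M → ℝ)
    {K : Set (EuclideanSpace ℝ (Fin d))} (hK : IsCompact K) :
    ∃ f ∈ DeepCNN d s, ∀ x ∈ K, f x = ∑ m, c m * reluRidge (a m) (t m) x := by
  obtain ⟨W, hW⟩ := exists_coeff_eq_inner M a
  obtain ⟨J₀, q, hJ₀, hq2, hprod⟩ := exists_prod_natDegree_le_two W
  have hq : ∀ l, (q l).natDegree ≤ s := fun l => (hq2 l).trans hs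
  -- Trivial factors are added until the last layer has all the coordinates that are read off.
  set J := J₀ + M * d with hJ
  choose B hB using fun j i : ℕ => hK.exists_bound_of_continuousOn
    (continuous_coeff_linearPart (d := d) q j i).continuousOn
  set idx : Fin M → Fin (d + J * s) := fun m => ⟨m * d + (d - 1), by
    have h1 : (m : ℕ) * d ≤ M * d := Nat.mul_le_mul_right d m.2.le
    have h2 : J ≤ J * s := Nat.le_mul_of_pos_right J (by omega)
    omega⟩ with hidx
  have hinj : Function.Injective idx := by
    intro m m' h
    have h1 : (m : ℕ) * d + (d - 1) = m' * d + (d - 1) := congrArg Fin.val h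
    exact Fin.ext (Nat.eq_of_mul_eq_mul_right hd (by omega))
  -- The thresholds sit in the coordinates that are read off; the others are never used.
  set t' : ℕ → ℝ := fun i => if h : ∃ m, (idx m : ℕ) = i then t h.choose else 0 with ht'
  have ht'_idx : ∀ m, t' (idx m) = t m := by
    intro m
    have h : ∃ m', (idx m' : ℕ) = idx m := ⟨m, rfl⟩
    simp only [ht', dif_pos h]
    exact congrArg t (hinj (Fin.ext h.choose_spec))
  set T : ℕ → ℕ → ℝ := fun j i => if j = 0 then 0 else if j < J then B j i else -t' i with hT
  let out : (Fin (d + J * s) → ℝ) →ₗ[ℝ] ℝ := ∑ m, c m • LinearMap.proj (idx m)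
  refine ⟨⟨fun x => out (convLayer d s (fun l => filterMask (q (l - 1))) (shiftBias d s q T) x J),
    out.continuous_of_finiteDimensional.comp (continuous_convLayer _ _ J)⟩,
    ⟨J, _, _, out.toAffineMap, by omega, fun j => isFilterMask_filterMask (hq _), fun x => rfl⟩,
    fun x hx => ?_⟩
  have hlayer := convLayer_eq_max hq T (by simp [hT]) x (J := J) (by
    intro j hj h1 i
    have h2 := hB j i x hx
    rw [Real.norm_eq_abs] at h2
    simpa [hT, hj, show j ≠ 0 by omega] using h2) (by omega)
  simp only [ContinuousMap.coe_mk, out, LinearMap.sum_apply, LinearMap.smul_apply,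
    LinearMap.proj_apply, smul_eq_mul, reluRidge]
  refine Finset.sum_congr rfl fun m _ => ?_
  rw [hlayer, linearPart, hprod J (by omega)]
  have hTm : T J (idx m) = -t m := by simp [hT, ht'_idx, show J ≠ 0 by omega]
  rw [hTm, show ((idx m : Fin (d + J * s)) : ℕ) = m * d + (d - 1) from rfl, hW, ← sub_eq_add_neg]

/-! ### Density of shallow networks -/

/-- Membership in a closure for the compact-open topology: uniform approximation on compact
sets. -/
theorem ContinuousMap.mem_closure_iff_forall_isCompact {X Y : Type*} [TopologicalSpace X]
    [PseudoMetricSpace Y] {A : Set C(X, Y)} {g : C(X, Y)} :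
    g ∈ closure A ↔ ∀ K : Set X, IsCompact K → ∀ ε > 0, ∃ f ∈ A, ∀ x ∈ K, dist (f x) (g x) < ε := by
  rw [mem_closure_iff_nhds_basis
    (nhds_basis_uniformity (Metric.uniformity_basis_dist.compactConvergenceUniformity))]
  simp only [Prod.forall, and_imp, Set.mem_ofPred_eq]
  exact ⟨fun h K hK ε hε => h K ε hK hε, fun h K ε hK hε => h K hK ε hε⟩

/-- The shifted rectifier `u ↦ max 0 (u - t)`. -/
noncomputable def reluShift (t : ℝ) : C(ℝ, ℝ) where
  toFun u := max 0 (u - t)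
  continuous_toFun := by fun_prop

/-- Piecewise linear interpolation with knots `a + j η`, `j ≤ N`, continued by a constant. Beyond
the last knot a further interval only adds a multiple of a ramp, a difference of two shifted
rectifiers. -/
theorem exists_span_reluShift_interpolation (h : C(ℝ, ℝ)) {a b η ε : ℝ} (hη : 0 < η)
    (hω : ∀ u ∈ Set.Icc a b, ∀ v ∈ Set.Icc a b, |u - v| ≤ η → |h u - h v| ≤ ε / 2) (N : ℕ)
    (hN : a + N * η ≤ b) :
    ∃ L ∈ Submodule.span ℝ (Set.range reluShift), (∀ u ≥ a + N * η, L u = h (a + N * η)) ∧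
      ∀ u ∈ Set.Icc a (a + N * η), |L u - h u| ≤ ε := by
  induction N with
  | zero =>
    have hL : ∀ u ≥ a, (h a • (reluShift (a - 1) - reluShift a)) u = h a := by
      intro u hu
      simp only [ContinuousMap.smul_apply, ContinuousMap.sub_apply, reluShift,
        ContinuousMap.coe_mk, smul_eq_mul]
      rw [max_eq_right (by linarith), max_eq_right (by linarith)]
      ring
    -- To the right of `a`, the constant `1` is a difference of two shifted rectifiers.
    refine ⟨h a • (reluShift (a - 1) - reluShift a), Submodule.smul_mem _ _ (Submodule.sub_mem _
      (Submodule.subset_span ⟨_, rfl⟩) (Submodule.subset_span ⟨_, rfl⟩)), ?_, ?_⟩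
    · simpa using hL
    · intro u hu
      have hua : u = a := le_antisymm (by simpa using hu.2) hu.1
      have hab : a ∈ Set.Icc a b := ⟨le_rfl, by simpa using hN⟩
      have h0 := hω a hab a hab (by simpa using hη.le)
      rw [hL u hu.1, hua]
      simp only [sub_self, abs_zero] at h0 ⊢
      linarith
  | succ N ih =>
    have hstep : a + ((N + 1 : ℕ) : ℝ) * η = a + N * η + η := by push_cast; ring
    rw [hstep] at hN ⊢
    have hτa : a ≤ a + N * η := by have := mul_nonneg N.cast_nonneg hη.le; linarith
    obtain ⟨L, hL, hL1, hL2⟩ := ih (by linarith)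
    set τ := a + N * η with hτ
    set c := (h (τ + η) - h τ) / η with hc
    refine ⟨L + c • (reluShift τ - reluShift (τ + η)), Submodule.add_mem _ hL
      (Submodule.smul_mem _ _ (Submodule.sub_mem _ (Submodule.subset_span ⟨_, rfl⟩)
        (Submodule.subset_span ⟨_, rfl⟩))), fun u hu => ?_, fun u hu => ?_⟩
    · simp only [ContinuousMap.add_apply, ContinuousMap.smul_apply, ContinuousMap.sub_apply,
        reluShift, ContinuousMap.coe_mk, smul_eq_mul]
      rw [hL1 u (by linarith), max_eq_right (by linarith), max_eq_right (by linarith), hc]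
      field_simp
      ring
    · simp only [ContinuousMap.add_apply, ContinuousMap.smul_apply, ContinuousMap.sub_apply,
        reluShift, ContinuousMap.coe_mk, smul_eq_mul]
      rw [max_eq_left (by linarith [hu.2] : u - (τ + η) ≤ 0)]
      rcases le_total u τ with huτ | huτ
      · rw [max_eq_left (by linarith)]
        simpa using hL2 u ⟨hu.1, huτ⟩
      · rw [hL1 u huτ, max_eq_right (by linarith), sub_zero]
        have hτmem : τ ∈ Set.Icc a b := ⟨hτa, by linarith⟩
        have h1 := hω τ hτmem u ⟨hu.1, by linarith [hu.2]⟩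
          (by rw [abs_sub_comm, abs_of_nonneg (by linarith)]; linarith [hu.2])
        have h2 := hω (τ + η) ⟨by linarith, hN⟩ τ hτmem
          (by rw [add_sub_cancel_left, abs_of_pos hη])
        have h3 : |c * (u - τ)| ≤ ε / 2 := by
          rw [hc, div_mul_eq_mul_div, mul_div_assoc, abs_mul]
          refine (mul_le_of_le_one_right (abs_nonneg _) ?_).trans h2
          rw [abs_of_nonneg (div_nonneg (by linarith) hη.le), div_le_one hη]
          linarith [hu.2]
        calc |h τ + c * (u - τ) - h u| = |(h τ - h u) + c * (u - τ)| := by ring_nf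
          _ ≤ |h τ - h u| + |c * (u - τ)| := abs_add_le _ _
          _ ≤ ε := by linarith

theorem dense_span_reluShift :
    Dense (Submodule.span ℝ (Set.range reluShift) : Set C(ℝ, ℝ)) := by
  intro h
  rw [ContinuousMap.mem_closure_iff_forall_isCompact]
  intro K hK ε hε
  obtain ⟨R, hR⟩ := hK.isBounded.subset_closedBall 0
  have hKR : K ⊆ Set.Icc (-|R|) |R| := fun u hu => by
    have := hR hu
    rw [mem_closedBall_zero_iff, Real.norm_eq_abs] at this
    exact abs_le.1 (this.trans (le_abs_self R))
  obtain ⟨δ, hδ, hω⟩ := Metric.uniformContinuousOn_iff.1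
    ((isCompact_Icc (a := -|R|) (b := |R| + 1)).uniformContinuousOn_of_continuous
      h.continuous.continuousOn) (ε / 4) (by linarith)
  -- One interval more than needed to cover `[-|R|, |R|]` makes the step size positive.
  obtain ⟨N, hN⟩ := exists_nat_gt ((2 * |R| + 1) / δ)
  have hlen : 0 < 2 * |R| + 1 := by positivity
  have hN0 : (0 : ℝ) < N := (div_pos hlen hδ).trans hN
  have hNη : -|R| + N * ((2 * |R| + 1) / N) = |R| + 1 := by field_simp; ring
  obtain ⟨L, hL, -, hL2⟩ := exists_span_reluShift_interpolation h (a := -|R|) (b := |R| + 1)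
    (η := (2 * |R| + 1) / N) (ε := ε / 2) (div_pos hlen hN0) (fun u hu v hv huv => by
      have := hω u hu v hv (huv.trans_lt (by rwa [div_lt_comm₀ hN0 hδ]))
      rw [Real.dist_eq] at this
      linarith) N hNη.le
  refine ⟨L, hL, fun u hu => ?_⟩
  rw [hNη] at hL2
  have := hL2 u ⟨(hKR hu).1, by linarith [(hKR hu).2]⟩
  rw [Real.dist_eq]
  linarith

theorem comp_inner_mem_closure_span_reluRidge {d : ℕ} (h : C(ℝ, ℝ))
    (a : EuclideanSpace ℝ (Fin d)) :
    h.comp ⟨fun x => inner ℝ a x, by fun_prop⟩ ∈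
      closure (Submodule.span ℝ (Set.range (Function.uncurry (reluRidge (d := d)))) :
        Set C(EuclideanSpace ℝ (Fin d), ℝ)) := by
  refine map_mem_closure (f := fun g : C(ℝ, ℝ) => g.comp ⟨fun x => inner ℝ a x, by fun_prop⟩)
    (ContinuousMap.continuous_precomp _) (dense_span_reluShift h) ?_
  intro g hg
  induction hg using Submodule.span_induction with
  | mem g hg =>
    obtain ⟨t, rfl⟩ := hg
    exact Submodule.subset_span ⟨(a, t), rfl⟩
  | zero => exact Submodule.zero_mem _
  | add f g _ _ hf hg => exact Submodule.add_mem _ hf hg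
  | smul c g _ hg => exact Submodule.smul_mem _ c hg

/-- The exponential ridge function `x ↦ exp ⟪a, x⟫`. -/
noncomputable def expRidge {d : ℕ} (a : EuclideanSpace ℝ (Fin d)) :
    C(EuclideanSpace ℝ (Fin d), ℝ) :=
  (⟨Real.exp, Real.continuous_exp⟩ : C(ℝ, ℝ)).comp ⟨fun x => inner ℝ a x, by fun_prop⟩

/-- Shallow ReLU networks approximate the functions `expRidge a`, whose span is a subalgebra that
separates points, and hence they are dense by the Stone–Weierstrass theorem. -/
theorem dense_span_reluRidge (d : ℕ) :
    Dense (Submodule.span ℝ (Set.range (Function.uncurry (reluRidge (d := d)))) :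
      Set C(EuclideanSpace ℝ (Fin d), ℝ)) := by
  set M := Submodule.span ℝ (Set.range (Function.uncurry (reluRidge (d := d)))) with hM
  set A := Algebra.adjoin ℝ (Set.range (expRidge (d := d))) with hA
  have hAM : (A : Set C(EuclideanSpace ℝ (Fin d), ℝ)) ⊆ closure M := by
    have hmon : ∀ f ∈ Submonoid.closure (Set.range (expRidge (d := d))),
        f ∈ Set.range (expRidge (d := d)) := by
      intro f hf
      induction hf using Submonoid.closure_induction with
      | mem f hf => exact hf
      | one => exact ⟨0, by ext x; simp [expRidge]⟩
      | mul f g _ _ hf hg =>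
        obtain ⟨a, rfl⟩ := hf
        obtain ⟨b, rfl⟩ := hg
        exact ⟨a + b, by ext x; simp [expRidge, inner_add_left, Real.exp_add]⟩
    have hle : Subalgebra.toSubmodule A ≤ M.topologicalClosure := by
      rw [hA, Algebra.adjoin_eq_span, Submodule.span_le]
      intro f hf
      obtain ⟨a, rfl⟩ := hmon f hf
      exact comp_inner_mem_closure_span_reluRidge _ a
    exact hle
  have hsep : A.SeparatesPoints := by
    intro x y hxy
    refine ⟨expRidge (x - y), ⟨_, Algebra.subset_adjoin ⟨x - y, rfl⟩, rfl⟩, fun h => hxy ?_⟩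
    have h1 : inner ℝ (x - y) x = inner ℝ (x - y) y := Real.exp_injective h
    rw [← sub_eq_zero, ← inner_sub_right, inner_self_eq_zero, sub_eq_zero] at h1
    exact h1
  have hAd : Dense (A : Set C(EuclideanSpace ℝ (Fin d), ℝ)) := by
    intro g
    rw [ContinuousMap.mem_closure_iff_forall_isCompact]
    intro K hK ε hε
    exact ContinuousMap.exists_mem_subalgebra_near_continuous_of_isCompact_of_separatesPoints
      hsep g hK hε
  exact dense_closure.1 (hAd.mono hAM)

/-- Universality of deep convolutional networks. -/
theorem dense_deepCNN {d s : ℕ} (hs : 2 ≤ s) (hd : 1 ≤ d) : Dense (DeepCNN d s) := by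
  intro g
  rw [ContinuousMap.mem_closure_iff_forall_isCompact]
  intro K hK ε hε
  obtain ⟨h, hh, hhg⟩ := ContinuousMap.mem_closure_iff_forall_isCompact.1
    (dense_span_reluRidge d g) K hK ε hε
  obtain ⟨M, c, r, rfl⟩ := Submodule.mem_span_set'.1 hh
  choose p hp using fun m => (r m).2
  obtain ⟨f, hf, hfK⟩ := exists_deepCNN_eqOn hs hd M (fun m => (p m).1) (fun m => (p m).2) c hK
  refine ⟨f, hf, fun x hx => ?_⟩
  convert hhg x hx using 2
  rw [hfK x hx]
  simp only [ContinuousMap.coe_sum, ContinuousMap.coe_smul, Finset.sum_apply, Pi.smul_apply,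
    smul_eq_mul, ← hp]
  rfl

/-! ### Approximation of maps into the unit interval -/

theorem denseRange_sigmoid_comp (Z : Type*) [TopologicalSpace Z] :
    DenseRange fun f : C(Z, ℝ) =>
      (⟨unitInterval.sigmoid, unitInterval.continuous_sigmoid⟩ : C(ℝ, I)).comp f := by
  intro g
  rw [ContinuousMap.mem_closure_iff_forall_isCompact]
  intro K _ ε hε
  -- `g` is moved into `[δ, 1 - δ]`, where the logistic function can be inverted.
  set δ := min (ε / 2) (1 / 4) with hδ
  have hδ0 : 0 < δ := by positivity
  have hδ1 : δ ≤ ε / 2 := min_le_left _ _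
  have hδ2 : δ ≤ 1 / 4 := min_le_right _ _
  set c : Z → ℝ := fun z => (1 - 2 * δ) * g z + δ with hc
  have hcont : Continuous c := by fun_prop
  have hpos : ∀ z, 0 < c z := fun z => by
    have := mul_nonneg (by linarith : (0 : ℝ) ≤ 1 - 2 * δ) (g z).2.1
    simp only [hc]
    linarith
  have hlt : ∀ z, c z < 1 := fun z => by
    have := mul_le_of_le_one_right (by linarith : (0 : ℝ) ≤ 1 - 2 * δ) (g z).2.2
    simp only [hc]
    linarith
  have hpos' : ∀ z, 0 < (c z)⁻¹ - 1 := fun z => sub_pos.2 ((one_lt_inv₀ (hpos z)).2 (hlt z))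
  refine ⟨_, ⟨⟨fun z => -Real.log ((c z)⁻¹ - 1), ?_⟩, rfl⟩, fun z _ => ?_⟩
  · exact (((hcont.inv₀ fun z => (hpos z).ne').sub continuous_const).log
      fun z => (hpos' z).ne').neg
  · have hval : Real.sigmoid (-Real.log ((c z)⁻¹ - 1)) = c z := by
      simp [Real.sigmoid_def, Real.exp_log (hpos' z)]
    rw [Subtype.dist_eq, Real.dist_eq]
    change |Real.sigmoid (-Real.log ((c z)⁻¹ - 1)) - (g z : ℝ)| < ε
    have h0 : (0 : ℝ) ≤ g z := (g z).2.1
    have h1 : (g z : ℝ) ≤ 1 := (g z).2.2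
    have h2 := mul_nonneg hδ0.le h0
    have h3 := mul_le_of_le_one_right hδ0.le h1
    rw [hval, abs_lt]
    constructor <;> simp only [hc] <;> linarith

/-- Deep convolutional networks followed by the logistic function are universal for continuous
maps into the unit interval. -/
theorem exists_deepCNN_sigmoid_near {d s : ℕ} (hs : 2 ≤ s) (hd : 1 ≤ d)
    (g : C(EuclideanSpace ℝ (Fin d), I)) {K : Set (EuclideanSpace ℝ (Fin d))} (hK : IsCompact K)
    {ε : ℝ} (hε : 0 < ε) :
    ∃ f ∈ DeepCNN d s, ∀ y ∈ K, dist (unitInterval.sigmoid (f y)) (g y) < ε := by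
  have h := (denseRange_sigmoid_comp (EuclideanSpace ℝ (Fin d))).dense_image
    (ContinuousMap.continuous_postcomp _) (dense_deepCNN hs hd) g
  obtain ⟨_, ⟨f, hf, rfl⟩, hfK⟩ :=
    ContinuousMap.mem_closure_iff_forall_isCompact.1 h K hK ε hε
  exact ⟨f, hf, hfK⟩

/-- On a compact set the injection `φ` is an embedding, so by the Tietze extension theorem every
function there factors through `φ`. -/
theorem exists_comp_eqOn_of_isCompact {X E : Type*} [TopologicalSpace X] [TopologicalSpace E]
    [T2Space E] [NormalSpace E] (φ : C(X, E)) (hφ : Function.Injective φ) (g : C(X, I))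
    {K : Set X} (hK : IsCompact K) : ∃ G : C(E, I), ∀ x ∈ K, G (φ x) = g x := by
  have : CompactSpace K := isCompact_iff_compactSpace.1 hK
  have he : IsClosedEmbedding fun x : K => φ x :=
    (φ.continuous.comp continuous_subtype_val).isClosedEmbedding
      (hφ.comp Subtype.val_injective)
  obtain ⟨G, hG⟩ := (g.restrict K).exists_extension' he
  exact ⟨G, fun x hx => congrFun hG ⟨x, hx⟩⟩

theorem dense_logisticLift {X : Type*} [TopologicalSpace X] {d n s : ℕ} (hs : 2 ≤ s) (hd : 1 ≤ d)
    (φ : C(X, EuclideanSpace ℝ (Fin d))) (hφ : Function.Injective φ) :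
    Dense {g : C(X, Fin n → I) | ∃ f : Fin n → C(EuclideanSpace ℝ (Fin d), ℝ),
      (∀ i, f i ∈ DeepCNN d s) ∧ g = logisticLift φ f} := by
  intro g
  rw [ContinuousMap.mem_closure_iff_forall_isCompact]
  intro K hK ε hε
  choose G hG using fun i => exists_comp_eqOn_of_isCompact φ hφ
    (ContinuousMap.comp ⟨fun y : Fin n → I => y i, continuous_apply i⟩ g) hK
  choose f hf hfG using fun i =>
    exists_deepCNN_sigmoid_near hs hd (G i) (hK.image φ.continuous) hε
  refine ⟨logisticLift φ f, ⟨f, hf, rfl⟩, fun x hx => (dist_pi_lt_iff hε).2 fun i => ?_⟩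
  have h := hfG i (φ x) ⟨x, hx, rfl⟩
  rwa [hG i x hx] at h

/-! ### Sequences converging uniformly on compact sets -/

/-- Along a compact exhaustion of `X`, extensions of `g ∘ φ⁻¹` converge to `g`. -/
theorem exists_seq_comp_tendsto_of_exhaustion {X E : Type*} [TopologicalSpace X]
    [WeaklyLocallyCompactSpace X] [SigmaCompactSpace X] [TopologicalSpace E] [T2Space E]
    [NormalSpace E] (φ : C(X, E)) (hφ : Function.Injective φ) (g : C(X, I)) :
    ∃ G : ℕ → C(E, I), Tendsto (fun k => (G k).comp φ) atTop (𝓝 g) := by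
  set κ : CompactExhaustion X := default
  choose G hG using fun k => exists_comp_eqOn_of_isCompact φ hφ g (κ.isCompact k)
  refine ⟨G, ContinuousMap.tendsto_iff_forall_isCompact_tendstoUniformlyOn.2 fun K hK => ?_⟩
  obtain ⟨m, hm⟩ := κ.exists_superset_of_isCompact hK
  rw [Metric.tendstoUniformlyOn_iff]
  intro ε hε
  filter_upwards [eventually_ge_atTop m] with k hk x hx
  simpa [hG k x (κ.subset hk (hm hx))] using hε

/-- The Lipschitz regularizations `y ↦ inf_a (g a + k |y - a|)` of a function `g` on an arbitrary
subset are defined everywhere and converge to `g` uniformly on compact sets. -/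
theorem exists_seq_restrict_tendsto {E : Type*} [MetricSpace E] (A : Set E) (g : C(A, I)) :
    ∃ G : ℕ → C(E, I), Tendsto (fun k => (G k).restrict A) atTop (𝓝 g) := by
  -- The infimum over the empty set is not meaningful.
  rcases isEmpty_or_nonempty A with hA | hA
  · refine ⟨fun _ => ContinuousMap.const E 0, ?_⟩
    have : (ContinuousMap.const E (0 : I)).restrict A = g := by ext x; exact hA.elim x
    simpa only [this] using! tendsto_const_nhds (x := g)
  set F : ℕ → E → ℝ := fun k y => ⨅ a : A, ((g a : ℝ) + k * dist y (a : E)) with hF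
  have hbdd : ∀ (k : ℕ) (y : E),
      BddBelow (Set.range fun a : A => ((g a : ℝ) + k * dist y (a : E))) := fun k y =>
    ⟨0, by rintro _ ⟨a, rfl⟩; exact add_nonneg (g a).2.1 (by positivity)⟩
  have hlip : ∀ k : ℕ, LipschitzWith (k : NNReal) (F k) := by
    refine fun k => LipschitzWith.of_le_add_mul _ fun y z => ?_
    rw [← sub_le_iff_le_add]
    refine le_ciInf fun a => ?_
    rw [sub_le_iff_le_add]
    refine (ciInf_le (hbdd k y) a).trans ?_
    have := mul_le_mul_of_nonneg_left (dist_triangle y z (a : E)) (k.cast_nonneg (α := ℝ))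
    simp only [NNReal.coe_natCast]
    linarith
  have h0 : ∀ k y, 0 ≤ F k y := fun k y =>
    le_ciInf fun a => add_nonneg (g a).2.1 (by positivity)
  have hle : ∀ k (a : A), F k a ≤ g a := fun k a => by
    simpa using ciInf_le (hbdd k a) a
  refine ⟨fun k => ⟨fun y => Set.projIcc 0 1 zero_le_one (F k y),
    continuous_projIcc.comp (hlip k).continuous⟩,
    ContinuousMap.tendsto_iff_forall_isCompact_tendstoUniformlyOn.2 fun K hK => ?_⟩
  rw [Metric.tendstoUniformlyOn_iff]
  intro ε hε
  -- Points of `A` close to `K` count as well, hence uniform continuity on `K` alone is not enough.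
  obtain ⟨δ, hδ, hω⟩ := Metric.mem_uniformity_dist.1 (hK.uniformContinuousAt_of_continuousAt g
    (fun a _ => g.continuous.continuousAt) (Metric.dist_mem_uniformity (half_pos hε)))
  obtain ⟨m, hm⟩ := exists_nat_gt δ⁻¹
  filter_upwards [eventually_ge_atTop m] with k hk x hx
  have hkδ : 1 ≤ k * δ := by
    rw [← inv_le_iff_one_le_mul₀ hδ]
    exact hm.le.trans (by exact_mod_cast hk)
  have hlow : (g x : ℝ) - ε / 2 ≤ F k x := by
    refine le_ciInf fun a => ?_
    have ha0 : (0 : ℝ) ≤ g a := (g a).2.1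
    have hx1 : (g x : ℝ) ≤ 1 := (g x).2.2
    rcases lt_or_ge (dist x a) δ with h | h
    · have h1 : dist (g x) (g a) < ε / 2 := hω h hx
      rw [Subtype.dist_eq, Real.dist_eq, abs_lt] at h1
      have h2 : (0 : ℝ) ≤ k * dist (x : E) a := by positivity
      linarith
    · have h1 := mul_le_mul_of_nonneg_left h (k.cast_nonneg (α := ℝ))
      rw [Subtype.dist_eq] at h1
      linarith
  have hval : ((Set.projIcc (0 : ℝ) 1 zero_le_one (F k x) : I) : ℝ) = F k x :=
    congrArg Subtype.val
      (Set.projIcc_of_mem zero_le_one ⟨h0 k x, (hle k x).trans (g x).2.2⟩)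
  rw [Subtype.dist_eq, Real.dist_eq]
  change |(g x : ℝ) - (Set.projIcc (0 : ℝ) 1 zero_le_one (F k x) : I)| < ε
  rw [hval, abs_of_nonneg (sub_nonneg.2 (hle k x))]
  linarith

theorem exists_seq_comp_tendsto_of_isEmbedding {X E : Type*} [TopologicalSpace X] [MetricSpace E]
    (φ : C(X, E)) (hφ : IsEmbedding φ) (g : C(X, I)) :
    ∃ G : ℕ → C(E, I), Tendsto (fun k => (G k).comp φ) atTop (𝓝 g) := by
  set e : X ≃ₜ Set.range φ := hφ.toHomeomorph
  obtain ⟨G, hG⟩ := exists_seq_restrict_tendsto (Set.range φ) (g.comp (e.symm : C(Set.range φ, X)))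
  refine ⟨G, ?_⟩
  have h := ((ContinuousMap.continuous_precomp (e : C(X, Set.range φ))).tendsto _).comp hG
  have hcomp : (g.comp (e.symm : C(Set.range φ, X))).comp (e : C(X, Set.range φ)) = g := by
    ext x
    simp
  rwa [hcomp] at h

/-- If the functions `g i` are approximated by maps of the form `G ∘ φ` uniformly on compact sets,
then a diagonal sequence of networks, close to the `k`-th approximant on the ball of radius `k`,
approximates them as well. -/
theorem exists_seq_logisticLift_tendsto {X : Type*} [TopologicalSpace X] {d n s : ℕ} (hs : 2 ≤ s)
    (hd : 1 ≤ d) (φ : C(X, EuclideanSpace ℝ (Fin d))) (g : C(X, Fin n → I))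
    (hg : ∀ i, ∃ G : ℕ → C(EuclideanSpace ℝ (Fin d), I), Tendsto (fun k => (G k).comp φ) atTop
      (𝓝 (ContinuousMap.comp ⟨fun y : Fin n → I => y i, continuous_apply i⟩ g))) :
    ∃ f : ℕ → Fin n → C(EuclideanSpace ℝ (Fin d), ℝ), (∀ k i, f k i ∈ DeepCNN d s) ∧
      Tendsto (fun k => logisticLift φ (f k)) atTop (𝓝 g) := by
  choose G hG using hg
  choose f hf hfG using fun (k : ℕ) i => exists_deepCNN_sigmoid_near hs hd (G i k)
    (isCompact_closedBall (0 : EuclideanSpace ℝ (Fin d)) k) (Nat.one_div_pos_of_nat (n := k))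
  refine ⟨f, hf, ContinuousMap.tendsto_iff_forall_isCompact_tendstoUniformlyOn.2 fun K hK => ?_⟩
  rw [Metric.tendstoUniformlyOn_iff]
  intro ε hε
  obtain ⟨R, hR⟩ := (hK.image φ.continuous).isBounded.subset_closedBall 0
  obtain ⟨m, hm⟩ := exists_nat_ge R
  obtain ⟨l, hl⟩ := exists_nat_one_div_lt (half_pos hε)
  have hGK := eventually_all.2 fun i => Metric.tendstoUniformlyOn_iff.1
    (ContinuousMap.tendsto_iff_forall_isCompact_tendstoUniformlyOn.1 (hG i) K hK) _ (half_pos hε)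
  filter_upwards [hGK, eventually_ge_atTop m, eventually_ge_atTop l] with k hk hmk hlk x hx
  refine (dist_pi_lt_iff hε).2 fun i => ?_
  have hball : φ x ∈ Metric.closedBall (0 : EuclideanSpace ℝ (Fin d)) k :=
    Metric.closedBall_subset_closedBall (hm.trans (by exact_mod_cast hmk)) (hR ⟨x, hx, rfl⟩)
  have h1 := hfG k i (φ x) hball
  have h2 : dist (g x i) (G i k (φ x)) < ε / 2 := hk i x hx
  have h3 := (Nat.one_div_le_one_div (α := ℝ) hlk).trans_lt hl
  have h4 := dist_triangle_right (g x i) (unitInterval.sigmoid (f k i (φ x))) (G i k (φ x))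
  change dist (g x i) (unitInterval.sigmoid (f k i (φ x))) < ε
  linarith

/-! ### Soft classifiers -/

/-- Every open set of a metric space is the set where some continuous function with values in
`[0, 1]` exceeds `α`. -/
theorem exists_preimage_Ioc_eq {X : Type*} [PseudoMetricSpace X] {α : ℝ}
    (hα : α ∈ Set.Ioo (0 : ℝ) 1) {U : Set X} (hU : IsOpen U) :
    ∃ g : C(X, I), (fun x => (g x : ℝ)) ⁻¹' Set.Ioc α 1 = U := by
  -- The distance to the empty set has the junk value `0`, so `U = univ` is treated apart.
  rcases Set.eq_empty_or_nonempty Uᶜ with h | h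
  · rw [Set.compl_empty_iff] at h
    subst h
    refine ⟨ContinuousMap.const X 1, ?_⟩
    ext x
    simpa using hα.2
  · have hmem : ∀ x, α + (1 - α) * min 1 (Metric.infDist x Uᶜ) ∈ I := fun x => by
      have h0 : 0 ≤ min 1 (Metric.infDist x Uᶜ) := le_min zero_le_one Metric.infDist_nonneg
      have h1 : min 1 (Metric.infDist x Uᶜ) ≤ 1 := min_le_left _ _
      have h2 : 0 ≤ 1 - α := by linarith [hα.2]
      have h3 := mul_nonneg h2 h0
      have h4 := mul_le_of_le_one_right h2 h1
      exact ⟨by linarith [hα.1], by linarith⟩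
    refine ⟨⟨fun x => ⟨_, hmem x⟩, ?_⟩, ?_⟩
    · exact Continuous.subtype_mk (continuous_const.add (continuous_const.mul
        (continuous_const.min (Metric.continuous_infDist_pt _)))) _
    · ext x
      have h1 : (x ∈ U) ↔ 0 < Metric.infDist x Uᶜ := by
        rw [← hU.isClosed_compl.notMem_iff_infDist_pos h, Set.notMem_compl_iff]
      rw [h1, Set.mem_preimage, Set.mem_Ioc]
      simp only [ContinuousMap.coe_mk, (hmem x).2, and_true, lt_add_iff_pos_right]
      rw [mul_pos_iff_of_pos_left (by linarith [hα.2]), lt_min_iff]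
      simp

theorem exists_isSoftClassifier {X : Type*} [PseudoMetricSpace X] {n : ℕ} {α : ℝ}
    (hα : α ∈ Set.Ioo (0 : ℝ) 1) (U : Fin n → TopologicalSpace.Opens X) :
    ∃ g : C(X, Fin n → I), IsSoftClassifier α U g := by
  choose g hg using fun i => exists_preimage_Ioc_eq hα (U i).isOpen
  refine ⟨ContinuousMap.pi g, ?_, hg⟩
  ext x i
  exact (Set.ext_iff.1 (hg i) x).symm

theorem mainTheorem10 {X : Type*} [MetricSpace X] {d n s : ℕ} (hs : 2 ≤ s) (hsd : s ≤ d)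
    (U : Fin n → TopologicalSpace.Opens X)
    (φ : C(X, EuclideanSpace ℝ (Fin d))) (hφ : Function.Injective φ)
    (α : ℝ) (hα : α ∈ Set.Ioo (0 : ℝ) 1) :
    -- hard-soft decomposition
    (∃ ŝ : C(X, Fin n → I), IsSoftClassifier α U ŝ) ∧
    -- universal classification, for every soft classifier
    ((LocallyCompactSpace X ∧ TopologicalSpace.SeparableSpace X) ∨ IsEmbedding φ →
      ∀ ŝ : C(X, Fin n → I), IsSoftClassifier α U ŝ →
        ∃ f : ℕ → Fin n → C(EuclideanSpace ℝ (Fin d), ℝ),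
          (∀ k i, f k i ∈ DeepCNN d s) ∧
          (∀ κ : Set X, κ.Nonempty → IsCompact κ → ∀ ε : ℝ, 0 < ε →
            ∃ K : ℕ, ∀ k ≥ K, ∀ x ∈ κ, ∀ i,
              |(logisticLift φ (f k) x i : ℝ) - (ŝ x i : ℝ)| < ε) ∧
          Tendsto (fun k => (hardThreshold α n).comp (logisticLift φ (f k))) atTop
            (𝓝 (idealClassifier U))) ∧
    -- density of the lifted architecture in `C(X, [0,1]^n)`
    Dense {g : C(X, Fin n → I) | ∃ f : Fin n → C(EuclideanSpace ℝ (Fin d), ℝ),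
      (∀ i, f i ∈ DeepCNN d s) ∧ g = logisticLift φ f} := by

  have hd : 1 ≤ d := by omega
  refine ⟨exists_isSoftClassifier hα U, fun hX ŝ hŝ => ?_, dense_logisticLift hs hd φ hφ⟩
  obtain ⟨f, hf, hlim⟩ := exists_seq_logisticLift_tendsto hs hd φ ŝ fun i => by
    rcases hX with ⟨_, _⟩ | hX
    · have := UniformSpace.secondCountable_of_separable X
      exact exists_seq_comp_tendsto_of_exhaustion φ hφ _
    · exact exists_seq_comp_tendsto_of_isEmbedding φ hX _
  refine ⟨f, hf, fun κ _ hκ ε hε => ?_, ?_⟩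
  · obtain ⟨K, hK⟩ := eventually_atTop.1 (Metric.tendstoUniformlyOn_iff.1
      (ContinuousMap.tendsto_iff_forall_isCompact_tendstoUniformlyOn.1 hlim κ hκ) ε hε)
    refine ⟨K, fun k hk x hx i => ?_⟩
    have h := (dist_pi_lt_iff hε).1 (hK k hk x hx) i
    rwa [dist_comm, Subtype.dist_eq, Real.dist_eq] at h
  · rw [hŝ.1]
    exact ((ContinuousMap.continuous_postcomp (hardThreshold α n)).tendsto ŝ).comp hlim
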